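/- **Setting.** Let $n,k\ge 0$, let $A\in\mathbb R^{k\times n}$ have rank $k$, let $\phi(v)_i=\max\{v_i,0\}$, and let $$M(x)=w^T\phi(W_1\phi(W_2\phi(\cdots W_d\,\phi(Ax))\cdots)),\qquad x\in\mathbb R^n,$$ where $d\ge 0$, $W_i\in\mathbb R^{k_i\times k_{i+1}}$, $k_{d+1}=k$ and $w\in\mathbb R^{k_1}$, with arbitrary widths $k_i$. Let $N=k+k_1+\dots+k_d$ be the number of neurons. The sign pattern $\mathrm{sign}(v)$ of a vector is its set of non-zero coordinates. For $\gamma>0$ assume: * *Assumption 1.* For every $S\subseteq[k]$, $\Pr_{g\sim\mathcal N(0,I_n)}[\mathrm{sign}(\phi(Ag))=S]\ge\gamma/2^k$. * *Assumption 2.* For all nonempty $S_i\subseteq[k_i]$ $(1\le i\le d)$, every entry of $w^T\prod_{i=1}^d(W_i)_{S_i}\in\mathbb R^k$ is non-zero, where $(W_i)_{S_i}$ is $W_i$ with the rows outside $S_i$ set to zero; moreover $\Pr_{g\sim\mathcal N(0,I_n)}[M(g)=0]\le\gamma/8$. **Algorithm.** The inputs are $n,k,\gamma$, a failure probability $\delta\in(0,1)$,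 a step size $\varepsilon>0$ and oracle access to $M$. With $C\in\mathbb N$ an absolute constant, set $r=\lceil C\,k\log(k/\delta)/\gamma\rceil$. For $i=1,\dots,r$ draw an independent $g^i\sim\mathcal N(0,I_n)$ and compute the gradient of $M$ at $g^i$ by finite differences: $z^i_j=(M(g^i+\varepsilon e_j)-M(g^i))/\varepsilon$, $1\le j\le n$. Return $V=\mathrm{span}(z^1,\dots,z^r)$, represented by $z^1,\dots,z^r$. The algorithm runs on a real RAM: an arithmetic operation or logarithm on reals, a memory access, a counter increment and a standard Gaussian sample each cost one step; rounding up to an integer $m$ costs $1+m$; an oracle query costs $1+n$; a loop costs one step plus one step per iteration, besides its body. **Theorem.** There are absolute constants $C,c\in\mathbb N$ and $K$ and a polynomial $T$ in four variables such that, for every such network satisfying Assumptions 1 and 2 with parameter $\gamma$, every $\delta\in(0,1)$ and every $0<\varepsilon\le\gamma\delta^2/2^{cN}$: 1. the query points depend only on the inputs $n,k,\gamma,\delta,\varepsilon$ and the random samples, not on the answers of the oracle (the algorithm is non-adaptive); 2. the algorithm always makes at most $K\cdot kn\log(k/\delta)/\gamma$ queries to $M$; 3. the algorithm always stops within $T(n,k,1/\gamma,\log(1/\delta))$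 steps; 4. with probability at least $1-\delta$, $V$ is contained in the row span of $A$ and $\dim V\ge k/2$. -/

import Mathlib

open MeasureTheory ProbabilityTheory
open scoped Matrix

noncomputable section

namespace SpanRecovery

/-! ## Deep ReLU networks -/

/-- The ReLU `φ`, applied to each coordinate. -/
def relu {m : ℕ} (v : Fin m → ℝ) : Fin m → ℝ := fun i => max (v i) 0

/-- The hidden weight matrices `W₁, …, W_d`, outermost first, of a network whose innermost hidden
width is `k` and whose outermost hidden width is `a`: a composable chain `W₁ ∈ ℝ^(a × k₂)`,
`W₂ ∈ ℝ^(k₂ × k₃)`, …, `W_d ∈ ℝ^(k_d × k)`, of any length `d ≥ 0` and with arbitrary widths. -/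
inductive Layers (k : ℕ) : ℕ → Type
  | nil : Layers k k
  | cons {a b : ℕ} (W : Matrix (Fin a) (Fin b) ℝ) (L : Layers k b) : Layers k a

/-- `v ↦ φ(W₁ φ(W₂ ⋯ φ(W_d v)))`. -/
def Layers.eval {k : ℕ} : {a : ℕ} → Layers k a → (Fin k → ℝ) → (Fin a → ℝ)
  | _, .nil, v => v
  | _, .cons W L, v => relu (W *ᵥ L.eval v)

/-- The number `k₁ + ⋯ + k_d` of neurons in the layers `W₁, …, W_d`. -/
def Layers.neurons {k : ℕ} : {a : ℕ} → Layers k a → ℕ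
  | _, .nil => 0
  | a, .cons _ L => a + L.neurons

/-- `W_S`: the rows of `W` outside `S` are replaced by zero. -/
def maskRows {a b : ℕ} (S : Finset (Fin a)) (W : Matrix (Fin a) (Fin b) ℝ) :
    Matrix (Fin a) (Fin b) ℝ :=
  Matrix.of fun i j => if i ∈ S then W i j else 0

/-- All products `(W₁)_{S₁} (W₂)_{S₂} ⋯ (W_d)_{S_d}` with every `S_i` nonempty. -/
def Layers.maskedProducts {k : ℕ} : {a : ℕ} → Layers k a → Set (Matrix (Fin a) (Fin k) ℝ)
  | _, .nil => {1}
  | a, .cons W L =>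
      {Q | ∃ S : Finset (Fin a), S.Nonempty ∧ ∃ P ∈ L.maskedProducts, Q = maskRows S W * P}

/-- The network `M(x) = wᵀ φ(W₁ φ(W₂ φ(⋯ W_d φ(A x))))`. -/
def network {n k a : ℕ} (w : Fin a → ℝ) (L : Layers k a) (A : Matrix (Fin k) (Fin n) ℝ) :
    (Fin n → ℝ) → ℝ :=
  fun x => w ⬝ᵥ L.eval (relu (A *ᵥ x))

/-- The sign pattern of a vector: the set of its non-zero coordinates. -/
def signPattern {m : ℕ} (v : Fin m → ℝ) : Finset (Fin m) :=
  open scoped Classical in Finset.univ.filter fun i => v i ≠ 0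

/-- The Gaussian distribution `N(0, I_n)`. -/
def gaussianVector (n : ℕ) : Measure (Fin n → ℝ) :=
  Measure.pi fun _ => gaussianReal 0 1

/-- Near-uniform orthant probabilities: for `g ~ N(0, I_n)`, every sign pattern of `φ(A g)` has
probability at least `γ / 2^k`. -/
def OrthantAssumption {n k : ℕ} (A : Matrix (Fin k) (Fin n) ℝ) (γ : ℝ) : Prop :=
  ∀ S : Finset (Fin k),
    γ / 2 ^ k ≤ (gaussianVector n).real {g | signPattern (relu (A *ᵥ g)) = S}

/-- Non-degeneracy: `wᵀ ∏ (W_i)_{S_i}` is entry-wise non-zero for all nonempty `S_i`, and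
`M(g) = 0` with probability at most `γ / 8` for `g ~ N(0, I_n)`. -/
def NondegeneracyAssumption {n k a : ℕ} (w : Fin a → ℝ) (L : Layers k a)
    (A : Matrix (Fin k) (Fin n) ℝ) (γ : ℝ) : Prop :=
  (∀ P ∈ L.maskedProducts, ∀ j, (w ᵥ* P) j ≠ 0) ∧
    (gaussianVector n).real {g | network w L A g = 0} ≤ γ / 8

/-! ## A randomized real RAM with an oracle

Registers and arrays are numbered. There are natural-number registers (loop counters and
addresses), real registers and real arrays, all initially `0` unless they hold an input. -/

/-- The binary operations on real registers. -/
inductive ArithOp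
  | add | sub | mul | div

def ArithOp.eval : ArithOp → ℝ → ℝ → ℝ
  | .add, x, y => x + y
  | .sub, x, y => x - y
  | .mul, x, y => x * y
  | .div, x, y => x / y

/-- Programs. -/
inductive Prog
  /-- natural register `i := i + 1` -/
  | inc (i : ℕ)
  /-- natural register `i := ⌈real register x⌉` (`0` if negative) -/
  | ceil (i x : ℕ)
  /-- real register `x := c` -/
  | const (x c : ℕ)
  /-- real register `x := natural register i` -/
  | ofNat (x i : ℕ)
  /-- real registers, `x := y op z` -/
  | arith (op : ArithOp) (x y z : ℕ)
  /-- real registers, `x := log y` (natural logarithm) -/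
  | log (x y : ℕ)
  /-- real register `x := array a at address (natural register i)` -/
  | get (x a i : ℕ)
  /-- array `a` at address (natural register `i`) `:=` real register `x` -/
  | put (a i x : ℕ)
  /-- real register `x :=` fresh standard Gaussian -/
  | gauss (x : ℕ)
  /-- real register `x :=` the oracle's answer at the point stored in the first `n` cells of
  array `a`, where `n` is the dimension of the oracle -/
  | query (x a : ℕ)
  /-- sequential composition -/
  | seq (p q : Prog)
  /-- `for i = 0, …, (natural register c) - 1 do p` -/
  | loop (i c : ℕ) (p : Prog)

infixr:60 " ;; " => Prog.seq

/-- The configuration of the machine, with the points queried so far (latest first), the number of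
Gaussians drawn so far and the number of steps made so far. -/
structure State (n : ℕ) where
  nat : ℕ → ℕ
  real : ℕ → ℝ
  arr : ℕ → ℕ → ℝ
  drawn : ℕ
  queries : List (Fin n → ℝ)
  steps : ℕ

/-- Charge `c` steps. -/
def State.tick {n : ℕ} (s : State n) (c : ℕ) : State n := { s with steps := s.steps + c }

def State.setNat {n : ℕ} (s : State n) (i v : ℕ) : State n :=
  { s with nat := Function.update s.nat i v }

def State.setReal {n : ℕ} (s : State n) (x : ℕ) (v : ℝ) : State n :=
  { s with real := Function.update s.real x v }

def State.setArr {n : ℕ} (s : State n) (a i : ℕ) (v : ℝ) : State n :=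
  { s with arr := Function.update s.arr a (Function.update (s.arr a) i v) }

/-- Run a program with oracle `M` and random tape `ω`, the `t`-th Gaussian drawn being `ω t`.
Every instruction costs one step, with three exceptions: rounding up costs one plus the resulting
integer, a query costs one plus the dimension of the query point, and a loop costs one step plus
one step per iteration, on top of the cost of its body. -/
def exec {n : ℕ} (M : (Fin n → ℝ) → ℝ) (ω : ℕ → ℝ) : Prog → State n → State n
  | .inc i, s => (s.setNat i (s.nat i + 1)).tick 1
  | .ceil i x, s => (s.setNat i ⌈s.real x⌉₊).tick (1 + ⌈s.real x⌉₊)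
  | .const x c, s => (s.setReal x c).tick 1
  | .ofNat x i, s => (s.setReal x (s.nat i)).tick 1
  | .arith op x y z, s => (s.setReal x (op.eval (s.real y) (s.real z))).tick 1
  | .log x y, s => (s.setReal x (Real.log (s.real y))).tick 1
  | .get x a i, s => (s.setReal x (s.arr a (s.nat i))).tick 1
  | .put a i x, s => (s.setArr a (s.nat i) (s.real x)).tick 1
  | .gauss x, s => ({ s.setReal x (ω s.drawn) with drawn := s.drawn + 1 } : State n).tick 1
  | .query x a, s =>
      ({ s.setReal x (M fun j => s.arr a j) with
          queries := (fun j : Fin n => s.arr a j) :: s.queries } : State n).tick (1 + n)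
  | .seq p q, s => exec M ω q (exec M ω p s)
  | .loop i c p, s =>
      (List.range (s.nat c)).foldl (fun s t => exec M ω p ((s.setNat i t).tick 1)) (s.tick 1)

/-! ## The span recovery algorithm

Natural registers: `0` holds `n`, `1` holds `k`, `2` holds `r`, `3` and `4` are the loop counters
`i` and `j`, `5` is the next free address of the output.
Real registers: `0` holds `γ`, `1` holds `δ`, `2` holds the step size `ε`; `3`, `4`, `5` are
scratch. Array `0` holds the current query point and array `1` the gradients found so far. -/

/-- `r := ⌈C k log(k/δ) / γ⌉`. -/
def setRounds (C : ℕ) : Prog :=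
  .ofNat 3 1 ;;
  .arith .div 4 3 1 ;;
  .log 4 4 ;;
  .arith .mul 4 3 4 ;;
  .const 3 C ;;
  .arith .mul 4 3 4 ;;
  .arith .div 4 4 0 ;;
  .ceil 2 4

/-- Draw `g ~ N(0, I_n)` into array `0`. -/
def drawPoint : Prog :=
  .loop 4 0 (.gauss 3 ;; .put 0 4 3)

/-- Append the gradient of the oracle at `g`, computed by finite differences
`(M(g + ε e_j) - M(g)) / ε` for `j = 1, …, n`, to array `1`. -/
def computeGradient : Prog :=
  .query 5 0 ;;
  .loop 4 0
    (.get 3 0 4 ;;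
     .arith .add 4 3 2 ;;
     .put 0 4 4 ;;
     .query 4 0 ;;
     .put 0 4 3 ;;
     .arith .sub 4 4 5 ;;
     .arith .div 4 4 2 ;;
     .put 1 5 4 ;;
     .inc 5)

/-- Span recovery with non-adaptive gradients: compute the gradients at
`r = ⌈C k log(k/δ) / γ⌉` independent Gaussian points. -/
def spanRecovery (C : ℕ) : Prog :=
  setRounds C ;;
  .loop 3 2 (drawPoint ;; computeGradient)

/-- The machine with the inputs `n`, `k`, `γ`, `δ`, `ε`. -/
def input (n k : ℕ) (γ δ ε : ℝ) : State n where
  nat i := if i = 0 then n else if i = 1 then k else 0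
  real x := if x = 0 then γ else if x = 1 then δ else if x = 2 then ε else 0
  arr _ _ := 0
  drawn := 0
  queries := []
  steps := 0

/-- The final configuration of the span recovery algorithm. -/
def run (C : ℕ) {n : ℕ} (k : ℕ) (γ δ ε : ℝ) (M : (Fin n → ℝ) → ℝ) (ω : ℕ → ℝ) : State n :=
  exec M ω (spanRecovery C) (input n k γ δ ε)

/-- The subspace returned: the span of the vectors `z⁰, …, z^{r-1}` stored one after the other in
array `1`. -/
def State.output {n : ℕ} (s : State n) : Submodule ℝ (Fin n → ℝ) :=
  Submodule.span ℝ {z | ∃ i < s.nat 2, z = fun j : Fin n => s.arr 1 (i * n + j)}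

/-- The law of the random tape: i.i.d. standard Gaussians. -/
def tapeMeasure : Measure (ℕ → ℝ) :=
  Measure.infinitePi fun _ => gaussianReal 0 1

end SpanRecovery

end

/-!
The network is homogeneous and piecewise linear. On the linear region of `g` its gradient is
`gradCoeff w L A g ᵥ* A` (`vecMul_regionMatrix`), a combination of the rows of `A`. The regions
are bounded by at most `4 ^ N` hyperplanes through the origin
(`exists_region_matrices_and_normals`), and a Gaussian point lies within reach of a given one, for
steps of length `ε` along any coordinate axis, with probability at most `2ε` independently of the
dimension (`gaussianVector_slab_le`). So for `ε ≤ γδ² / 2 ^ (11 N)` all finite differences are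
exact gradients with probability at least `1 - δ/2`, and then the returned space lies in the row
span of `A`.

For the dimension, pass to the coefficient vectors, which loses nothing since `A` has full row
rank. Where the network does not vanish, the support of the coefficient vector is the sign pattern
of the first layer (`signPattern_gradCoeff`). A subspace of dimension less than `k / 2` realizes
at most half of all supports (`two_mul_card_supports_le`, by the Sauer–Shelah inequality), so a
new sample leaves it with probability at least `γ/2 - γ/8` (`le_measureReal_gradCoeff_notMem`).
Following the potential `2 ^ (-dim)` over `r` samples (`pi_finrank_lt_le`), the span stays too
small with probability at most `2 ^ k * (1 - 3γ/16) ^ r ≤ δ/2`.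

The remaining claims hold for every oracle and every random tape and are read off from loop
invariants that give the complete list of queries and the exact number of steps
(`run_afterRounds`). The bound on the number of queries has no additive constant; this is possible
because the assumptions force `k ≥ 3` (`three_le_width`).
-/

noncomputable section

namespace SpanRecovery

/-! ### Gaussian preliminaries -/

lemma infinitePi_map_comp {ι κ X : Type*} [MeasurableSpace X] (μ : Measure X)
    [IsProbabilityMeasure μ] {f : κ → ι} (hf : Function.Injective f) :
    (Measure.infinitePi fun _ : ι => μ).map (fun ω => ω ∘ f) =
      Measure.infinitePi fun _ : κ => μ := by
  classical
  refine Measure.eq_infinitePi _ fun s t ht => ?_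
  rw [Measure.map_apply (by fun_prop) (.pi s.countable_toSet fun i _ => ht i)]
  have hpre : (fun ω : ι → X => ω ∘ f) ⁻¹' (s : Set κ).pi t =
      ((s.image f : Finset ι) : Set ι).pi (Function.extend f t fun _ => Set.univ) := by
    ext ω
    simp [hf.extend_apply]
  rw [hpre, Measure.infinitePi_pi, Finset.prod_image hf.injOn]
  · simp [hf.extend_apply]
  · intro i hi
    obtain ⟨j, -, rfl⟩ := Finset.mem_image.1 hi
    rw [hf.extend_apply]
    exact ht j

/-- The consecutive blocks of length `n` of the random tape. -/
def tapeBlocks (n : ℕ) (ω : ℕ → ℝ) (i : ℕ) (j : Fin n) : ℝ := ω (i * n + j)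

lemma tapeMeasure_map_blocks (n r : ℕ) :
    tapeMeasure.map (fun ω (i : Fin r) => tapeBlocks n ω i) =
      Measure.pi fun _ : Fin r => gaussianVector n := by
  have hinj : Function.Injective fun q : Fin r × Fin n => (q.1 : ℕ) * n + q.2 := by
    intro q q' h
    refine finProdFinEquiv.injective (Fin.ext ?_)
    simpa only [finProdFinEquiv_apply_val, mul_comm n, add_comm (Fin.val _)] using h
  have h₁ := infinitePi_map_comp (gaussianReal 0 1) hinj
  have h₂ := Measure.infinitePi_map_curry fun (_ : Fin r) (_ : Fin n) => gaussianReal 0 1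
  rw [← h₁, Measure.map_map (by fun_prop) (by fun_prop)] at h₂
  simp only [Measure.infinitePi_eq_pi] at h₂
  exact h₂

lemma gaussianReal_le_volume : gaussianReal 0 1 ≤ (volume : Measure ℝ) := by
  rw [gaussianReal_of_var_ne_zero 0 one_ne_zero]
  refine (withDensity_mono (.of_forall fun x => ?_)).trans_eq withDensity_one
  simp only [gaussianPDF, gaussianPDFReal, Pi.one_apply]
  rw [ENNReal.ofReal_le_one]
  refine mul_le_one₀ (inv_le_one_of_one_le₀ ?_) (Real.exp_nonneg _) (Real.exp_le_one_iff.2 ?_)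
  · rw [Real.one_le_sqrt]
    have := Real.pi_gt_three
    norm_num
    linarith
  · rw [sub_zero, neg_div]
    exact neg_nonpos.2 (by positivity)

lemma gaussianReal_slab_le {c d ε : ℝ} (hd : d ≠ 0) :
    gaussianReal 0 1 {t | |d * t + c| ≤ ε * |d|} ≤ ENNReal.ofReal (2 * ε) := by
  have hsub : {t | |d * t + c| ≤ ε * |d|} ⊆ Set.Icc (-c / d - ε) (-c / d + ε) := by
    intro t ht
    have h : |d| * |t - -c / d| ≤ |d| * ε := by
      rw [← abs_mul, mul_comm |d| ε]
      rw [mul_sub, mul_div_cancel₀ _ hd, sub_neg_eq_add]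
      exact ht
    have h' := abs_le.1 (le_of_mul_le_mul_left h (abs_pos.2 hd))
    exact ⟨by linarith, by linarith⟩
  calc _ ≤ volume (Set.Icc (-c / d - ε) (-c / d + ε)) :=
        (measure_mono hsub).trans (gaussianReal_le_volume _)
    _ = _ := by rw [Real.volume_Icc]; congr 1; ring

instance (n : ℕ) : IsProbabilityMeasure (gaussianVector n) := by
  unfold gaussianVector; infer_instance

instance : IsProbabilityMeasure tapeMeasure := by
  unfold tapeMeasure; infer_instance

/-- A Gaussian vector is so close to the hyperplane `h^⊥` that a step of length `ε` along some
coordinate axis can reach it with probability at most `2ε`, whatever the dimension: the slabs for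
the different axes are nested, and conditionally on the other coordinates the coordinate in which
`|h j|` is largest has to lie in an interval of length `2ε`. -/
lemma gaussianVector_slab_le {n : ℕ} (h : Fin n → ℝ) (hh : h ≠ 0) {ε : ℝ} (hε : 0 ≤ ε) :
    gaussianVector n {g | ∃ j, |h ⬝ᵥ g| ≤ ε * |h j|} ≤ ENNReal.ofReal (2 * ε) := by
  obtain ⟨j₀, hj₀⟩ := Function.ne_iff.1 hh
  obtain ⟨i, -, hi⟩ := Finset.exists_max_image Finset.univ (fun j => |h j|) ⟨j₀, Finset.mem_univ _⟩
  have hi0 : h i ≠ 0 := by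
    have := (abs_pos.2 hj₀).trans_le (hi j₀ (Finset.mem_univ _))
    exact abs_pos.1 this
  obtain ⟨m, rfl⟩ : ∃ m, n = m + 1 := ⟨n - 1, by have := i.pos; omega⟩
  have hsub : {g | ∃ j, |h ⬝ᵥ g| ≤ ε * |h j|} ⊆ {g | |h ⬝ᵥ g| ≤ ε * |h i|} := by
    rintro g ⟨j, hj⟩
    exact hj.trans (mul_le_mul_of_nonneg_left (hi j (Finset.mem_univ _)) hε)
  refine (measure_mono hsub).trans ?_
  have hmp := (measurePreserving_piFinSuccAbove (fun _ : Fin (m + 1) => gaussianReal 0 1) i).symm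
  have hmeas : MeasurableSet {g : Fin (m + 1) → ℝ | |h ⬝ᵥ g| ≤ ε * |h i|} :=
    measurableSet_le (by unfold dotProduct; fun_prop) measurable_const
  rw [gaussianVector, ← hmp.measure_preimage hmeas.nullMeasurableSet,
    Measure.prod_apply_symm (hmp.measurable hmeas)]
  calc _ ≤ ∫⁻ _, ENNReal.ofReal (2 * ε) ∂(Measure.pi fun _ : Fin m => gaussianReal 0 1) := by
        refine lintegral_mono fun y => ?_
        refine le_trans (measure_mono ?_)
          (gaussianReal_slab_le (c := ∑ j, h (i.succAbove j) * y j) hi0)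
        intro t ht
        have hins : (MeasurableEquiv.piFinSuccAbove (fun _ => ℝ) i).symm (t, y) =
          i.insertNth (α := fun _ => ℝ) t y := rfl
        simpa only [Set.mem_preimage, Set.mem_ofPred_eq, hins, dotProduct,
          Fin.sum_univ_succAbove _ i, Fin.insertNth_apply_same,
          Fin.insertNth_apply_succAbove] using ht
    _ = _ := by simp

/-! ### Supports of vectors in a subspace -/

/-- At most half of all sets are supports of vectors in a subspace of dimension less than `k / 2`.
If the family of supports shatters `I`, then the subspace contains, for each `i ∈ I`, a vector whose
support meets `I` in `{i}` only; these are independent, so `|I| < k / 2`. By the Sauer–Shelah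
inequality the supports are at most as many as the shattered sets, and complementation maps the
sets of size `< k / 2` injectively to sets of size `> k / 2`. -/
lemma two_mul_card_supports_le {k : ℕ} (U : Submodule ℝ (Fin k → ℝ))
    (hU : 2 * Module.finrank ℝ U < k) (𝒜 : Finset (Finset (Fin k)))
    (h𝒜 : ∀ S ∈ 𝒜, ∃ u ∈ U, signPattern u = S) : 2 * 𝒜.card ≤ 2 ^ k := by
  classical
  have hsh : ∀ I ∈ 𝒜.shatterer, 2 * I.card < k := by
    intro I hI
    rw [Finset.mem_shatterer] at hI
    have hex : ∀ i : I, ∃ u ∈ U, I ∩ signPattern u = {i.1} := fun i => by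
      obtain ⟨S, hS, h⟩ := hI.exists_inter_eq_singleton i.2
      obtain ⟨u, hu, rfl⟩ := h𝒜 S hS
      exact ⟨u, hu, h⟩
    choose u huU hu using hex
    have hz : ∀ i j : I, u i j ≠ 0 ↔ j = i := by
      intro i j
      have h := Finset.ext_iff.1 (hu i) j
      rw [Finset.mem_inter, Finset.mem_singleton, signPattern, Finset.mem_filter] at h
      rw [Subtype.ext_iff, ← h]
      exact ⟨fun h' => ⟨j.2, Finset.mem_univ _, h'⟩, fun h' => h'.2.2⟩
    have hli : LinearIndependent ℝ fun i : I => (⟨u i, huU i⟩ : U) := by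
      rw [Fintype.linearIndependent_iff]
      intro c hc j
      have h := congrFun (congrArg Subtype.val hc) j
      simp only [Submodule.coe_sum, Submodule.coe_smul, Finset.sum_apply, Pi.smul_apply,
        smul_eq_mul, ZeroMemClass.coe_zero, Pi.zero_apply] at h
      rw [Finset.sum_eq_single j] at h
      · exact (mul_eq_zero.1 h).resolve_right ((hz j j).2 rfl)
      · intro i _ hij
        rw [not_not.1 (mt (hz i j).1 (Ne.symm hij)), mul_zero]
      · simp
    have := hli.fintype_card_le_finrank
    rw [Fintype.card_coe] at this
    omega
  have hle := 𝒜.card_le_card_shatterer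
  have hdisj : Disjoint 𝒜.shatterer (𝒜.shatterer.image compl) := by
    rw [Finset.disjoint_left]
    intro I hI hI'
    obtain ⟨J, hJ, rfl⟩ := Finset.mem_image.1 hI'
    have h1 := hsh _ hI
    have h2 := hsh _ hJ
    rw [Finset.card_compl, Fintype.card_fin] at h1
    omega
  have hcard : (𝒜.shatterer ∪ 𝒜.shatterer.image compl).card ≤ 2 ^ k := by
    simpa using Finset.card_le_univ (𝒜.shatterer ∪ 𝒜.shatterer.image compl)
  rw [Finset.card_union_of_disjoint hdisj, Finset.card_image_of_injective _ compl_injective]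
    at hcard
  omega

/-! ### Growth of the span of independent samples -/

section Growth

variable {F : Type*} [AddCommGroup F] [Module ℝ F] [FiniteDimensional ℝ F]

/-- If a sample leaves every subspace of dimension less than `K` with probability at least `p`, then
`r` independent samples together with `U` span a space of dimension less than `K` with probability
at most `2 ^ (K - dim U) * (1 - p / 2) ^ r`. The potential `2 ^ (K - dim U)` shrinks in expectation
by the factor `1 - p / 2` with every sample. Finiteness of `Q` only serves to make all sets
measurable. -/
lemma pi_finrank_lt_le_of_finite {Q : Type*} [Finite Q] [MeasurableSpace Q]
    [MeasurableSingletonClass Q] (ν : Measure Q) [IsProbabilityMeasure ν] (v : Q → F) (K : ℕ)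
    {p : ℝ} (hp1 : p ≤ 1)
    (hp : ∀ U : Submodule ℝ F, Module.finrank ℝ U < K → p ≤ ν.real {q | v q ∉ U}) (r : ℕ) :
    ∀ U : Submodule ℝ F, (Measure.pi fun _ : Fin r => ν)
      {x | Module.finrank ℝ (U ⊔ Submodule.span ℝ (Set.range fun i => v (x i)) : Submodule ℝ F) < K}
        ≤ ENNReal.ofReal (2 ^ K / 2 ^ Module.finrank ℝ U * (1 - p / 2) ^ r) := by
  have hq0 : 0 ≤ 1 - p / 2 := by linarith
  induction r with
  | zero =>
    intro U
    by_cases hU : Module.finrank ℝ U < K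
    · refine prob_le_one.trans ?_
      rw [ENNReal.one_le_ofReal, pow_zero, mul_one, one_le_div (by positivity)]
      exact pow_le_pow_right₀ one_le_two hU.le
    · have : {x : Fin 0 → Q | Module.finrank ℝ (U ⊔ Submodule.span ℝ
          (Set.range fun i => v (x i)) : Submodule ℝ F) < K} = ∅ := by
        ext x
        simpa using (not_lt.1 hU).trans (Submodule.finrank_mono le_sup_left)
      rw [this, measure_empty]
      exact zero_le
  | succ r ih =>
    intro U
    by_cases hU : Module.finrank ℝ U < K
    swap
    · have : {x : Fin (r + 1) → Q | Module.finrank ℝ (U ⊔ Submodule.span ℝ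
          (Set.range fun i => v (x i)) : Submodule ℝ F) < K} = ∅ := by
        ext x
        simpa using (not_lt.1 hU).trans (Submodule.finrank_mono le_sup_left)
      rw [this, measure_empty]
      exact zero_le
    have hmp := (measurePreserving_piFinSuccAbove (fun _ : Fin (r + 1) => ν) 0).symm
    rw [← hmp.measure_preimage (Set.toFinite _).measurableSet.nullMeasurableSet,
      Measure.prod_apply (Set.toFinite _).measurableSet]
    obtain ⟨X, hX⟩ : ∃ X : ℝ, X = 2 ^ K / 2 ^ Module.finrank ℝ U * (1 - p / 2) ^ r := ⟨_, rfl⟩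
    have hX0 : 0 ≤ X := by rw [hX]; positivity
    set s : Set Q := {q | v q ∉ U} with hs
    have hsm : MeasurableSet s := (Set.toFinite _).measurableSet
    calc _ ≤ ∫⁻ q, (sᶜ.indicator (fun _ => ENNReal.ofReal X) q +
          s.indicator (fun _ => ENNReal.ofReal (X / 2)) q) ∂ν := by
          refine lintegral_mono fun q => ?_
          have hset : Prod.mk q ⁻¹' ((MeasurableEquiv.piFinSuccAbove (fun _ => Q) 0).symm ⁻¹'
              {x : Fin (r + 1) → Q | Module.finrank ℝ (U ⊔ Submodule.span ℝ
                (Set.range fun i => v (x i)) : Submodule ℝ F) < K}) =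
              {x : Fin r → Q | Module.finrank ℝ ((U ⊔ Submodule.span ℝ {v q}) ⊔ Submodule.span ℝ
                (Set.range fun i => v (x i)) : Submodule ℝ F) < K} := by
            ext x
            have hr : Set.range (fun i => v ((Fin.cons q x : Fin (r + 1) → Q) i)) =
                {v q} ∪ Set.range fun i => v (x i) := by
              ext y
              simp [Fin.exists_fin_succ, eq_comm]
            have hins : (MeasurableEquiv.piFinSuccAbove (fun _ => Q) 0).symm (q, x) =
              Fin.cons q x := Fin.insertNth_zero' q x
            simp only [Set.mem_preimage, Set.mem_ofPred_eq, hins]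
            rw [hr, Submodule.span_union, sup_assoc]
          simp only [hset]
          refine (ih _).trans ?_
          by_cases hq : q ∈ s
          · rw [Set.indicator_of_notMem (by simpa using hq), Set.indicator_of_mem hq, zero_add]
            apply ENNReal.ofReal_le_ofReal
            have hlt : Module.finrank ℝ U + 1 ≤
                Module.finrank ℝ (U ⊔ Submodule.span ℝ {v q} : Submodule ℝ F) :=
              Submodule.finrank_lt_finrank_of_lt (left_lt_sup.2 fun h =>
                hq (h (Submodule.mem_span_singleton_self _)))
            rw [hX, mul_div_right_comm, div_div, ← pow_succ]
            gcongr
            exact one_le_two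
          · rw [Set.indicator_of_mem (Set.mem_compl hq), Set.indicator_of_notMem hq, add_zero]
            apply ENNReal.ofReal_le_ofReal
            rw [hX]
            gcongr
            · exact one_le_two
            · exact Submodule.finrank_mono le_sup_left
      _ = ENNReal.ofReal (X * ν.real sᶜ + X / 2 * ν.real s) := by
          rw [lintegral_add_left (measurable_const.indicator hsm.compl),
            lintegral_indicator_const hsm.compl, lintegral_indicator_const hsm,
            ENNReal.ofReal_add (by positivity) (by positivity), ENNReal.ofReal_mul hX0,
            ENNReal.ofReal_mul (by positivity), ofReal_measureReal, ofReal_measureReal]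
      _ ≤ _ := by
          apply ENNReal.ofReal_le_ofReal
          rw [probReal_compl_eq_one_sub hsm, pow_succ, ← mul_assoc, ← hX]
          nlinarith [hp U hU]

/-- `pi_finrank_lt_le_of_finite` for a random vector with finitely many values, starting from the
zero subspace. -/
lemma pi_finrank_lt_le {E : Type*} [MeasurableSpace E] (μ : Measure E) [IsProbabilityMeasure μ]
    [MeasurableSpace F] [MeasurableSingletonClass F] {v : E → F} (hv : Measurable v)
    (hfin : (Set.range v).Finite) (K : ℕ) {p : ℝ} (hp1 : p ≤ 1)
    (hp : ∀ U : Submodule ℝ F, Module.finrank ℝ U < K → p ≤ μ.real {q | v q ∉ U}) (r : ℕ) :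
    (Measure.pi fun _ : Fin r => μ)
      {x | Module.finrank ℝ (Submodule.span ℝ (Set.range fun i => v (x i))) < K}
        ≤ ENNReal.ofReal (2 ^ K * (1 - p / 2) ^ r) := by
  have := hfin.to_subtype
  set f : E → Set.range v := Set.rangeFactorization v
  have hf : Measurable f := hv.subtype_mk
  have : IsProbabilityMeasure (μ.map f) := Measure.isProbabilityMeasure_map hf.aemeasurable
  have h := pi_finrank_lt_le_of_finite (μ.map f) (Subtype.val : Set.range v → F) K hp1
    (fun U hU => by
      rw [map_measureReal_apply hf (Set.toFinite _).measurableSet]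
      exact hp U hU) r ⊥
  rw [← Measure.pi_map_pi (fun _ => hf.aemeasurable)] at h
  have hf' : Measurable fun (x : Fin r → E) i => f (x i) := by fun_prop
  refine le_trans ?_ (h.trans (by simp))
  refine le_trans (measure_mono fun x hx => ?_) (Measure.le_map_apply hf'.aemeasurable _)
  rw [Set.mem_preimage, Set.mem_ofPred_eq, bot_sup_eq]
  exact hx

end Growth

/-! ### Linear regions of the network -/

lemma mem_signPattern_relu {m : ℕ} {y : Fin m → ℝ} {i : Fin m} :
    i ∈ signPattern (relu y) ↔ 0 < y i := by
  simp [signPattern, relu]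

/-- The product `(W₁)_{S₁} ⋯ (W_d)_{S_d}` in which `S_i` is the set of neurons of layer `i` that
are active when the hidden layers receive the input `u`. -/
def Layers.activeMatrix {k : ℕ} : {a : ℕ} → Layers k a → (Fin k → ℝ) → Matrix (Fin a) (Fin k) ℝ
  | _, .nil, _ => 1
  | _, .cons W L, u => maskRows (signPattern (relu (W *ᵥ L.eval u))) W * L.activeMatrix u

/-- The matrix of the linear map that the network without its output weights computes on the
linear region of the input `g`. -/
def regionMatrix {n k a : ℕ} (L : Layers k a) (A : Matrix (Fin k) (Fin n) ℝ) (g : Fin n → ℝ) :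
    Matrix (Fin a) (Fin n) ℝ :=
  L.activeMatrix (relu (A *ᵥ g)) * maskRows (signPattern (relu (A *ᵥ g))) A

/-- The coordinates of the gradient of the network at `g` in terms of the rows of `A`. -/
def gradCoeff {n k a : ℕ} (w : Fin a → ℝ) (L : Layers k a) (A : Matrix (Fin k) (Fin n) ℝ)
    (g : Fin n → ℝ) : Fin k → ℝ :=
  fun j => if j ∈ signPattern (relu (A *ᵥ g)) then
    (w ᵥ* L.activeMatrix (relu (A *ᵥ g))) j else 0

lemma maskRows_mul {a b c : ℕ} (S : Finset (Fin a)) (W : Matrix (Fin a) (Fin b) ℝ)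
    (B : Matrix (Fin b) (Fin c) ℝ) : maskRows S W * B = maskRows S (W * B) := by
  ext i j
  by_cases h : i ∈ S <;> simp [maskRows, Matrix.mul_apply, h]

lemma maskRows_signPattern_mulVec {a b : ℕ} (W : Matrix (Fin a) (Fin b) ℝ) (x : Fin b → ℝ) :
    maskRows (signPattern (relu (W *ᵥ x))) W *ᵥ x = relu (W *ᵥ x) := by
  ext i
  by_cases h : 0 < (W *ᵥ x) i
  · have h' := mem_signPattern_relu.2 h
    simp only [maskRows, Matrix.mulVec, dotProduct, Matrix.of_apply, h', if_true, relu] at h ⊢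
    exact (max_eq_left h.le).symm
  · have h' := mt mem_signPattern_relu.1 h
    simp only [maskRows, Matrix.mulVec, dotProduct, Matrix.of_apply, h', if_false, relu] at h ⊢
    rw [max_eq_right (not_lt.1 h)]
    simp

lemma Layers.activeMatrix_mulVec {k a : ℕ} (L : Layers k a) (u : Fin k → ℝ) :
    L.activeMatrix u *ᵥ u = L.eval u := by
  induction L with
  | nil => simp [activeMatrix, eval]
  | cons W L ih =>
    rw [activeMatrix, ← Matrix.mulVec_mulVec, ih, maskRows_signPattern_mulVec, eval]

lemma regionMatrix_mulVec {n k a : ℕ} (L : Layers k a) (A : Matrix (Fin k) (Fin n) ℝ)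
    (g : Fin n → ℝ) : regionMatrix L A g *ᵥ g = L.eval (relu (A *ᵥ g)) := by
  rw [regionMatrix, ← Matrix.mulVec_mulVec, maskRows_signPattern_mulVec, L.activeMatrix_mulVec]

lemma regionMatrix_nil {n k : ℕ} (A : Matrix (Fin k) (Fin n) ℝ) (g : Fin n → ℝ) :
    regionMatrix .nil A g = maskRows (signPattern (relu (A *ᵥ g))) A := by
  simp [regionMatrix, Layers.activeMatrix]

lemma regionMatrix_cons {n k a b : ℕ} (W : Matrix (Fin a) (Fin b) ℝ) (L : Layers k b)
    (A : Matrix (Fin k) (Fin n) ℝ) (g : Fin n → ℝ) :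
    regionMatrix (.cons W L) A g =
      maskRows (signPattern (relu ((W * regionMatrix L A g) *ᵥ g))) (W * regionMatrix L A g) := by
  rw [← Matrix.mulVec_mulVec, regionMatrix_mulVec, regionMatrix, Layers.activeMatrix,
    Matrix.mul_assoc, ← regionMatrix, maskRows_mul]

lemma network_eq_dotProduct {n k a : ℕ} (w : Fin a → ℝ) (L : Layers k a)
    (A : Matrix (Fin k) (Fin n) ℝ) (g : Fin n → ℝ) :
    network w L A g = (w ᵥ* regionMatrix L A g) ⬝ᵥ g := by
  rw [← Matrix.dotProduct_mulVec, regionMatrix_mulVec, network]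

lemma vecMul_maskRows {a b : ℕ} (S : Finset (Fin a)) (W : Matrix (Fin a) (Fin b) ℝ)
    (x : Fin a → ℝ) : x ᵥ* maskRows S W = (fun i => if i ∈ S then x i else 0) ᵥ* W := by
  ext j
  simp [Matrix.vecMul, dotProduct, maskRows, mul_ite, ite_mul]

/-- The gradient of the network on the region of `g` is the combination of the rows of `A` with
coefficients `gradCoeff`. -/
lemma vecMul_regionMatrix {n k a : ℕ} (w : Fin a → ℝ) (L : Layers k a)
    (A : Matrix (Fin k) (Fin n) ℝ) (g : Fin n → ℝ) :
    w ᵥ* regionMatrix L A g = gradCoeff w L A g ᵥ* A := by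
  rw [regionMatrix, ← Matrix.vecMul_vecMul, vecMul_maskRows]
  rfl

/-! ### The support of the gradient -/

lemma Layers.eval_zero {k a : ℕ} (L : Layers k a) : L.eval 0 = 0 := by
  induction L with
  | nil => rfl
  | cons W L ih => ext i; simp [eval, ih, relu]

lemma Layers.activeMatrix_mem_maskedProducts {k a : ℕ} (L : Layers k a) (u : Fin k → ℝ)
    (h : L.eval u ≠ 0) : L.activeMatrix u ∈ L.maskedProducts := by
  induction L with
  | nil => simp [activeMatrix, maskedProducts]
  | cons W L ih =>
    refine ⟨_, ?_, _, ih fun h0 => h ?_, rfl⟩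
    · obtain ⟨i, hi⟩ := Function.ne_iff.1 h
      exact ⟨i, by simpa [signPattern, eval] using hi⟩
    · ext i
      simp [eval, h0, relu]

/-- Where the network does not vanish, no hidden layer is entirely inactive, so the output
weights times the masked matrices have non-zero entries and the support of the coefficients of the gradient is
the sign pattern of the first layer. -/
lemma signPattern_gradCoeff {n k a : ℕ} {w : Fin a → ℝ} {L : Layers k a}
    {A : Matrix (Fin k) (Fin n) ℝ} (hP : ∀ P ∈ L.maskedProducts, ∀ j, (w ᵥ* P) j ≠ 0)
    {g : Fin n → ℝ} (hg : network w L A g ≠ 0) :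
    signPattern (gradCoeff w L A g) = signPattern (relu (A *ᵥ g)) := by
  have hmem := L.activeMatrix_mem_maskedProducts (relu (A *ᵥ g)) fun h => hg <| by
    simp [network, h]
  ext j
  conv_lhs => rw [signPattern]
  simp [gradCoeff, hP _ hmem j]

/-! ### Measurability -/

lemma measurable_relu {m : ℕ} : Measurable (relu (m := m)) := by
  unfold relu; fun_prop

lemma Layers.measurable_eval {k a : ℕ} (L : Layers k a) : Measurable L.eval := by
  induction L with
  | nil => exact measurable_id
  | cons W L ih =>
    refine measurable_relu.comp (measurable_pi_lambda _ fun i => ?_)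
    simp only [Matrix.mulVec, dotProduct]
    fun_prop

lemma measurable_mulVec {m n : ℕ} (A : Matrix (Fin m) (Fin n) ℝ) :
    Measurable fun g : Fin n → ℝ => A *ᵥ g := by
  refine measurable_pi_lambda _ fun i => ?_
  simp only [Matrix.mulVec, dotProduct]
  fun_prop

lemma Layers.measurable_activeMatrix {k a : ℕ} (L : Layers k a) (i : Fin a) (j : Fin k) :
    Measurable fun u => L.activeMatrix u i j := by
  induction L with
  | nil => exact measurable_const
  | cons W L ih =>
    simp only [activeMatrix, Matrix.mul_apply, maskRows, Matrix.of_apply, mem_signPattern_relu]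
    refine Finset.measurable_sum _ fun l _ => Measurable.mul ?_ (ih l)
    refine Measurable.ite (measurableSet_lt measurable_const ?_) measurable_const measurable_const
    exact (measurable_pi_apply i).comp ((measurable_mulVec W).comp L.measurable_eval)

lemma measurable_gradCoeff {n k a : ℕ} (w : Fin a → ℝ) (L : Layers k a)
    (A : Matrix (Fin k) (Fin n) ℝ) : Measurable (gradCoeff w L A) := by
  refine measurable_pi_lambda _ fun j => ?_
  simp only [gradCoeff, mem_signPattern_relu, Matrix.vecMul, dotProduct]
  have hA := measurable_mulVec A
  refine Measurable.ite (measurableSet_lt measurable_const ((measurable_pi_apply j).comp hA))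
    (Finset.measurable_sum _ fun l _ => measurable_const.mul
      ((L.measurable_activeMatrix l j).comp (measurable_relu.comp hA))) measurable_const

lemma Layers.finite_range_activeMatrix {k a : ℕ} (L : Layers k a) :
    (Set.range L.activeMatrix).Finite := by
  induction L with
  | nil => exact (Set.finite_singleton 1).subset (by rintro _ ⟨u, rfl⟩; rfl)
  | cons W L ih =>
    refine ((Set.finite_univ (α := Finset (Fin _))).image2
      (fun S P => maskRows S W * P) ih).subset ?_
    rintro _ ⟨u, rfl⟩
    exact ⟨_, Set.mem_univ _, _, ⟨u, rfl⟩, rfl⟩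

lemma finite_range_gradCoeff {n k a : ℕ} (w : Fin a → ℝ) (L : Layers k a)
    (A : Matrix (Fin k) (Fin n) ℝ) : (Set.range (gradCoeff w L A)).Finite := by
  refine ((Set.finite_univ (α := Finset (Fin k))).image2
    (fun S P j => if j ∈ S then (w ᵥ* P) j else 0) L.finite_range_activeMatrix).subset ?_
  rintro _ ⟨g, rfl⟩
  exact ⟨_, Set.mem_univ _, _, ⟨_, rfl⟩, rfl⟩

/-! ### Finite differences -/

lemma update_add_eq_add_single {n : ℕ} (g : Fin n → ℝ) (j : Fin n) (ε : ℝ) :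
    Function.update g j (g j + ε) = g + Pi.single j ε := by
  ext l
  by_cases hl : l = j
  · subst hl; simp
  · simp [hl]

/-- If `g` is farther from the hyperplane of each row of `B` than the step `ε` along the axis `j`
can bridge, then the step does not change the activation pattern. -/
lemma signPattern_relu_update {m n : ℕ} (B : Matrix (Fin m) (Fin n) ℝ) (g : Fin n → ℝ) (j : Fin n)
    {ε : ℝ} (hε : 0 ≤ ε) (h : ∀ i, B i = 0 ∨ ε * |B i j| < |B i ⬝ᵥ g|) :
    signPattern (relu (B *ᵥ Function.update g j (g j + ε))) = signPattern (relu (B *ᵥ g)) := by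
  ext i
  rw [mem_signPattern_relu, mem_signPattern_relu]
  have hval : (B *ᵥ Function.update g j (g j + ε)) i = (B *ᵥ g) i + ε * B i j := by
    rw [update_add_eq_add_single, Matrix.mulVec_add, Pi.add_apply, Matrix.mulVec_single]
    simp [mul_comm]
  have hBg : (B *ᵥ g) i = B i ⬝ᵥ g := rfl
  rw [hval, hBg]
  rcases h i with h | h
  · simp [h]
  · have h' : |ε * B i j| < |B i ⬝ᵥ g| := by rwa [abs_mul, abs_of_nonneg hε]
    constructor
    · intro h1
      by_contra h2
      rw [abs_of_nonpos (not_lt.1 h2)] at h'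
      linarith [le_abs_self (ε * B i j)]
    · intro h1
      rw [abs_of_pos h1] at h'
      linarith [neg_abs_le (ε * B i j)]

/-- Finitely many hyperplanes, the kernels of the non-zero `h ∈ H`, contain the boundaries of all
linear regions: every row of `W * B` is included, for each layer `W` and each matrix `B` that the
layers below it can realize. The family `ℬ` of realizable matrices carries the induction. -/
lemma exists_region_matrices_and_normals {n k a : ℕ} (L : Layers k a)
    (A : Matrix (Fin k) (Fin n) ℝ) {ε : ℝ} (hε : 0 ≤ ε) :
    ∃ (ℬ : Finset (Matrix (Fin a) (Fin n) ℝ)) (H : Finset (Fin n → ℝ)),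
      ℬ.card ≤ 2 ^ (k + L.neurons) ∧ H.card ≤ 4 ^ (k + L.neurons) ∧
      (∀ g, regionMatrix L A g ∈ ℬ) ∧
      ∀ g j, (∀ h ∈ H, h = 0 ∨ ε * |h j| < |h ⬝ᵥ g|) →
        regionMatrix L A (Function.update g j (g j + ε)) = regionMatrix L A g := by
  classical
  induction L with
  | nil =>
    refine ⟨Finset.univ.image fun S => maskRows S A, Finset.univ.image A, ?_, ?_, fun g => ?_,
      fun g j hg => ?_⟩
    · exact Finset.card_image_le.trans (by simp [Layers.neurons])
    · refine Finset.card_image_le.trans ?_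
      simpa [Layers.neurons] using (Nat.lt_pow_self (n := k) (by norm_num : 1 < 4)).le
    · rw [regionMatrix_nil]
      exact Finset.mem_image_of_mem _ (Finset.mem_univ _)
    · rw [regionMatrix_nil, regionMatrix_nil, signPattern_relu_update A g j hε fun i =>
        hg _ (Finset.mem_image_of_mem _ (Finset.mem_univ i))]
  | @cons a b W L ih =>
    obtain ⟨ℬ, H, hℬ, hH, hmem, hconst⟩ := ih
    refine ⟨(Finset.univ ×ˢ ℬ).image fun q => maskRows q.1 (W * q.2),
      H ∪ (Finset.univ ×ˢ ℬ).image fun q => (W * q.2) q.1, ?_, ?_, fun g => ?_, fun g j hg => ?_⟩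
    · refine Finset.card_image_le.trans ?_
      rw [Finset.card_product, Finset.card_univ, Fintype.card_finset, Fintype.card_fin,
        Layers.neurons, add_left_comm, pow_add]
      exact Nat.mul_le_mul_left _ hℬ
    · refine (Finset.card_union_le _ _).trans ?_
      refine (Nat.add_le_add hH (Finset.card_image_le.trans
        (Finset.card_product _ _).le)).trans ?_
      rw [Finset.card_univ, Fintype.card_fin, Layers.neurons, add_left_comm, pow_add 4 a]
      have h1 : 2 ^ (k + L.neurons) ≤ 4 ^ (k + L.neurons) := Nat.pow_le_pow_left (by norm_num) _
      -- This layer adds at most `a * 4 ^ N` normals, `N` counting the neurons below it.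
      have h2 : a + 1 ≤ 4 ^ a := Nat.lt_pow_self (by norm_num)
      calc _ ≤ 4 ^ (k + L.neurons) + a * 4 ^ (k + L.neurons) :=
            Nat.add_le_add_left (Nat.mul_le_mul_left _ (hℬ.trans h1)) _
        _ = (a + 1) * 4 ^ (k + L.neurons) := by ring
        _ ≤ _ := Nat.mul_le_mul_right _ h2
    · rw [regionMatrix_cons]
      exact Finset.mem_image.2 ⟨(_, _), Finset.mem_product.2 ⟨Finset.mem_univ _, hmem g⟩, rfl⟩
    · rw [regionMatrix_cons, regionMatrix_cons,
        hconst g j fun h hh => hg h (Finset.mem_union_left _ hh),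
        signPattern_relu_update (W * regionMatrix L A g) g j hε fun i =>
          hg _ (Finset.mem_union_right _ (Finset.mem_image.2 ⟨(i, regionMatrix L A g),
            Finset.mem_product.2 ⟨Finset.mem_univ _, hmem g⟩, rfl⟩))]

/-- The finite-difference gradient of `M` at `g` with step size `ε`. -/
def finiteDiff {n : ℕ} (M : (Fin n → ℝ) → ℝ) (ε : ℝ) (g : Fin n → ℝ) : Fin n → ℝ :=
  fun j => (M (Function.update g j (g j + ε)) - M g) / ε

lemma finiteDiff_network {n k a : ℕ} (w : Fin a → ℝ) (L : Layers k a)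
    (A : Matrix (Fin k) (Fin n) ℝ) {ε : ℝ} (hε : 0 < ε) (g : Fin n → ℝ)
    (h : ∀ j, regionMatrix L A (Function.update g j (g j + ε)) = regionMatrix L A g) :
    finiteDiff (network w L A) ε g = gradCoeff w L A g ᵥ* A := by
  ext j
  rw [finiteDiff, network_eq_dotProduct, network_eq_dotProduct, h j, update_add_eq_add_single,
    dotProduct_add, add_sub_cancel_left, dotProduct_single, mul_div_cancel_right₀ _ hε.ne',
    vecMul_regionMatrix]

lemma gaussianVector_finiteDiff_ne_le {n k a : ℕ} (w : Fin a → ℝ) (L : Layers k a)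
    (A : Matrix (Fin k) (Fin n) ℝ) {ε : ℝ} (hε : 0 < ε) :
    gaussianVector n {g | finiteDiff (network w L A) ε g ≠ gradCoeff w L A g ᵥ* A} ≤
      ENNReal.ofReal (4 ^ (k + L.neurons) * (2 * ε)) := by
  classical
  obtain ⟨-, H, -, hH, -, hconst⟩ := exists_region_matrices_and_normals L A hε.le
  have hsub : {g | finiteDiff (network w L A) ε g ≠ gradCoeff w L A g ᵥ* A} ⊆
      ⋃ h ∈ H.erase 0, {g | ∃ j, |h ⬝ᵥ g| ≤ ε * |h j|} := by
    intro g hg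
    by_contra hcon
    simp only [Set.mem_iUnion, Finset.mem_erase, Set.mem_ofPred_eq, not_exists, not_le] at hcon
    refine hg (finiteDiff_network w L A hε g fun j => hconst g j fun h hh => ?_)
    by_cases h0 : h = 0
    · exact .inl h0
    · exact .inr (hcon h ⟨h0, hh⟩ j)
  calc _ ≤ ∑ h ∈ H.erase 0, gaussianVector n {g | ∃ j, |h ⬝ᵥ g| ≤ ε * |h j|} :=
        (measure_mono hsub).trans (measure_biUnion_finset_le _ _)
    _ ≤ ∑ _h ∈ H.erase 0, ENNReal.ofReal (2 * ε) := Finset.sum_le_sum fun h hh =>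
        gaussianVector_slab_le h (Finset.ne_of_mem_erase hh) hε.le
    _ ≤ _ := by
        rw [Finset.sum_const, nsmul_eq_mul, ← ENNReal.ofReal_natCast,
          ← ENNReal.ofReal_mul (Nat.cast_nonneg _)]
        apply ENNReal.ofReal_le_ofReal
        gcongr
        exact_mod_cast (Finset.card_le_card (Finset.erase_subset _ _)).trans hH

/-! ### Probability of leaving a small subspace -/

lemma measurableSet_signPattern_eq {n k : ℕ} (A : Matrix (Fin k) (Fin n) ℝ)
    (S : Finset (Fin k)) : MeasurableSet {g | signPattern (relu (A *ᵥ g)) = S} := by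
  have : {g | signPattern (relu (A *ᵥ g)) = S} = ⋂ i, {g | 0 < (A *ᵥ g) i ↔ i ∈ S} := by
    ext g
    simp [Finset.ext_iff, mem_signPattern_relu]
  rw [this]
  refine MeasurableSet.iInter fun i => ?_
  have h : MeasurableSet {g | 0 < (A *ᵥ g) i} :=
    measurableSet_lt measurable_const ((measurable_pi_apply i).comp (measurable_mulVec A))
  by_cases hi : i ∈ S
  · simpa [hi] using h
  · simp only [hi, iff_false]
    exact h.compl

lemma OrthantAssumption.card_mul_le {n k : ℕ} {A : Matrix (Fin k) (Fin n) ℝ} {γ : ℝ}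
    (hA : OrthantAssumption A γ) (𝒜 : Finset (Finset (Fin k))) :
    𝒜.card * (γ / 2 ^ k) ≤ (gaussianVector n).real {g | signPattern (relu (A *ᵥ g)) ∈ 𝒜} := by
  have hU : {g | signPattern (relu (A *ᵥ g)) ∈ 𝒜} =
      ⋃ S ∈ 𝒜, {g | signPattern (relu (A *ᵥ g)) = S} := by
    ext g; simp
  rw [hU, measureReal_biUnion_finset (fun S _ T _ hST => Set.disjoint_left.2 fun g hS hT =>
    hST (hS.symm.trans hT)) fun S _ => measurableSet_signPattern_eq A S, ← nsmul_eq_mul]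
  exact Finset.card_nsmul_le_sum _ _ _ fun S _ => hA S

lemma OrthantAssumption.le_one {n k : ℕ} {A : Matrix (Fin k) (Fin n) ℝ} {γ : ℝ}
    (hA : OrthantAssumption A γ) : γ ≤ 1 := by
  have h := (hA.card_mul_le Finset.univ).trans measureReal_le_one
  rw [Finset.card_univ, Fintype.card_finset, Fintype.card_fin] at h
  push_cast at h
  rwa [mul_div_cancel₀ _ (by positivity)] at h

/-- If no neuron of the first layer is active, which has probability at least `γ / 2 ^ k`, then the
network vanishes, which has probability at most `γ / 8`. Hence `2 ^ k ≥ 8`. -/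
lemma three_le_width {n k a : ℕ} {w : Fin a → ℝ} {L : Layers k a}
    {A : Matrix (Fin k) (Fin n) ℝ} {γ : ℝ} (hγ : 0 < γ) (hA : OrthantAssumption A γ)
    (hM : NondegeneracyAssumption w L A γ) : 3 ≤ k := by
  have hsub : {g | signPattern (relu (A *ᵥ g)) = ∅} ⊆ {g | network w L A g = 0} := by
    intro g hg
    have h0 : relu (A *ᵥ g) = 0 := by
      ext i
      by_contra h
      have : i ∈ signPattern (relu (A *ᵥ g)) := by simpa [signPattern] using h
      rw [hg.out] at this
      exact absurd this (Finset.notMem_empty i)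
    simp [network, h0, L.eval_zero]
  have h := (hA ∅).trans ((measureReal_mono hsub).trans hM.2)
  by_contra hk
  have h2 : (2 : ℝ) ^ k ≤ 2 ^ 2 := pow_le_pow_right₀ one_le_two (by omega)
  have : γ / 4 ≤ γ / 2 ^ k := by gcongr; linarith
  linarith

/-- At least half of the sign patterns are not supports of vectors in `U`; they have total
probability at least `γ / 2`, and the support of `gradCoeff` differs from the sign pattern with probability at
most `γ / 8`. -/
lemma le_measureReal_gradCoeff_notMem {n k a : ℕ} {w : Fin a → ℝ} {L : Layers k a}
    {A : Matrix (Fin k) (Fin n) ℝ} {γ : ℝ} (hγ : 0 < γ) (hA : OrthantAssumption A γ)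
    (hM : NondegeneracyAssumption w L A γ) (U : Submodule ℝ (Fin k → ℝ))
    (hU : 2 * Module.finrank ℝ U < k) :
    3 * γ / 8 ≤ (gaussianVector n).real {g | gradCoeff w L A g ∉ U} := by
  classical
  set 𝒜 : Finset (Finset (Fin k)) := Finset.univ.filter fun S => ∃ u ∈ U, signPattern u = S
  have h𝒜 : 2 * 𝒜.card ≤ 2 ^ k := two_mul_card_supports_le U hU 𝒜 fun S hS =>
    (Finset.mem_filter.1 hS).2
  have hcard : (2 : ℝ) ^ k / 2 ≤ (𝒜ᶜ.card : ℝ) := by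
    have h := 𝒜.card_add_card_compl
    rw [Fintype.card_finset, Fintype.card_fin] at h
    have h' : (2 : ℝ) ^ k ≤ 2 * 𝒜ᶜ.card := by exact_mod_cast (by omega : 2 ^ k ≤ 2 * 𝒜ᶜ.card)
    linarith
  have hsub : {g | signPattern (relu (A *ᵥ g)) ∈ 𝒜ᶜ} ⊆
      {g | gradCoeff w L A g ∉ U} ∪ {g | network w L A g = 0} := by
    intro g hg
    by_contra hcon
    rw [Set.mem_union, not_or] at hcon
    exact Finset.mem_compl.1 hg.out (Finset.mem_filter.2 ⟨Finset.mem_univ _, _,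
      not_not.1 hcon.1, signPattern_gradCoeff hM.1 hcon.2⟩)
  have h1 := hA.card_mul_le 𝒜ᶜ
  have h2 := (measureReal_mono (μ := gaussianVector n) hsub).trans (measureReal_union_le _ _)
  have h3 : γ / 2 ≤ 𝒜ᶜ.card * (γ / 2 ^ k) := by
    calc γ / 2 = 2 ^ k / 2 * (γ / 2 ^ k) := by field_simp
      _ ≤ _ := by gcongr
  linarith [hM.2]

/-! ### Analysis of the program -/

/-- Loop rule: an invariant `P t` that holds after `t` iterations holds with `t = m` at the end. -/
lemma exec_loop_induction {n : ℕ} {M : (Fin n → ℝ) → ℝ} {ω : ℕ → ℝ} {i c : ℕ} {p : Prog}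
    {s : State n} {m : ℕ} (hm : s.nat c = m) (P : ℕ → State n → Prop) (h0 : P 0 (s.tick 1))
    (hstep : ∀ t < m, ∀ s, P t s → P (t + 1) (exec M ω p ((s.setNat i t).tick 1))) :
    P m (exec M ω (.loop i c p) s) := by
  rw [exec, hm]
  have : ∀ l ≤ m, P l ((List.range l).foldl
      (fun s t => exec M ω p ((s.setNat i t).tick 1)) (s.tick 1)) := by
    intro l
    induction l with
    | zero => exact fun _ => h0
    | succ l ih =>
      intro hl
      rw [List.range_succ, List.foldl_append]
      exact hstep l hl _ (ih (Nat.le_of_succ_le hl))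
  exact this m le_rfl

/-- The points queried while the gradient at `g` is computed, latest first. -/
def gradientQueries {n : ℕ} (ε : ℝ) (g : Fin n → ℝ) : List (Fin n → ℝ) :=
  (List.ofFn fun j => Function.update g j (g j + ε)).reverse ++ [g]

/-- The points queried in the first `t` rounds, latest first. -/
def roundQueries (n : ℕ) (ε : ℝ) (ω : ℕ → ℝ) : ℕ → List (Fin n → ℝ)
  | 0 => []
  | t + 1 => gradientQueries ε (tapeBlocks n ω t) ++ roundQueries n ε ω t

lemma length_roundQueries (n : ℕ) (ε : ℝ) (ω : ℕ → ℝ) (t : ℕ) :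
    (roundQueries n ε ω t).length = t * (n + 1) := by
  induction t with
  | zero => simp [roundQueries]
  | succ t ih => simp [roundQueries, gradientQueries, ih]; ring

/-- The state after `t` rounds with oracle `M` and random tape `ω`, `c` being the cost of the
preparations. -/
structure State.AfterRounds {n : ℕ} (M : (Fin n → ℝ) → ℝ) (ω : ℕ → ℝ) (ε : ℝ) (r c t : ℕ)
    (s : State n) : Prop where
  dim : s.nat 0 = n
  rounds : s.nat 2 = r
  step : s.real 2 = ε
  free : s.nat 5 = t * n
  drawn : s.drawn = t * n
  queries : s.queries = roundQueries n ε ω t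
  steps : s.steps = c + t * (n ^ 2 + 14 * n + 4)
  gradients : ∀ i < t, ∀ j : Fin n, s.arr 1 (i * n + j) = finiteDiff M ε (tapeBlocks n ω i) j

lemma exec_setRounds {n : ℕ} (M : (Fin n → ℝ) → ℝ) (ω : ℕ → ℝ) (C k : ℕ) (γ δ ε : ℝ) :
    let r := ⌈C * (k * Real.log (k / δ)) / γ⌉₊
    (exec M ω (setRounds C) (input n k γ δ ε)).AfterRounds M ω ε r (8 + r) 0 := by
  intro r
  constructor
  all_goals simp [setRounds, exec, input, State.tick, State.setNat, State.setReal,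
    ArithOp.eval, roundQueries, r, mul_comm]
  ring

lemma exec_drawPoint {n : ℕ} (M : (Fin n → ℝ) → ℝ) (ω : ℕ → ℝ) (s : State n) (h : s.nat 0 = n) :
    let s' := exec M ω drawPoint s
    (∀ i ≠ 4, s'.nat i = s.nat i) ∧ (∀ x ≠ 3, s'.real x = s.real x) ∧ s'.arr 1 = s.arr 1 ∧
      (∀ j : Fin n, s'.arr 0 j = ω (s.drawn + j)) ∧ s'.drawn = s.drawn + n ∧
      s'.queries = s.queries ∧ s'.steps = s.steps + 1 + n * 3 := by
  let P : ℕ → State n → Prop := fun t s' =>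
    (∀ i ≠ 4, s'.nat i = s.nat i) ∧ (∀ x ≠ 3, s'.real x = s.real x) ∧ s'.arr 1 = s.arr 1 ∧
      (∀ j < t, s'.arr 0 j = ω (s.drawn + j)) ∧ s'.drawn = s.drawn + t ∧
      s'.queries = s.queries ∧ s'.steps = s.steps + 1 + t * 3
  have hP : P n (exec M ω drawPoint s) := by
    refine exec_loop_induction h P ?_ ?_
    · simp [P, State.tick]
    · rintro t - u ⟨h1, h2, h3, h4, h5, h6, h7⟩
      refine ⟨fun i hi => ?_, fun x hx => ?_, ?_, fun j hj => ?_, ?_, ?_, ?_⟩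
      · simp [exec, State.tick, State.setNat, State.setReal, State.setArr, hi, h1]
      · simp [exec, State.tick, State.setNat, State.setReal, State.setArr, hx, h2]
      · simp [exec, State.tick, State.setNat, State.setReal, State.setArr, h3]
      · rcases Nat.lt_succ_iff_lt_or_eq.1 hj with hj | rfl
        · simp [exec, State.tick, State.setNat, State.setReal, State.setArr, hj.ne, h4 j hj]
        · simp [exec, State.tick, State.setNat, State.setReal, State.setArr, h5]
      · simp [exec, State.tick, State.setNat, State.setReal, State.setArr, h5, add_assoc]
      · simp [exec, State.tick, State.setNat, State.setReal, State.setArr, h6]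
      · simp [exec, State.tick, State.setNat, State.setReal, State.setArr, h7]
        ring
  obtain ⟨h1, h2, h3, h4, h5, h6, h7⟩ := hP
  exact ⟨h1, h2, h3, fun j => h4 j j.2, h5, h6, h7⟩

lemma exec_computeGradient {n : ℕ} (M : (Fin n → ℝ) → ℝ) (ω : ℕ → ℝ) (s : State n)
    (h : s.nat 0 = n) {ε : ℝ} (hε : s.real 2 = ε) (g : Fin n → ℝ)
    (hg : ∀ j : Fin n, s.arr 0 j = g j) :
    let s' := exec M ω computeGradient s
    (∀ i ≠ 4, i ≠ 5 → s'.nat i = s.nat i) ∧ s'.nat 5 = s.nat 5 + n ∧ s'.real 2 = ε ∧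
      (∀ l < s.nat 5, s'.arr 1 l = s.arr 1 l) ∧
      (∀ j : Fin n, s'.arr 1 (s.nat 5 + j) = finiteDiff M ε g j) ∧ s'.drawn = s.drawn ∧
      s'.queries = gradientQueries ε g ++ s.queries ∧
      s'.steps = s.steps + (n ^ 2 + 11 * n + 2) := by
  let Q : ℕ → List (Fin n → ℝ) := fun t =>
    ((List.ofFn fun j : Fin n => Function.update g j (g j + ε)).take t).reverse ++ g :: s.queries
  let P : ℕ → State n → Prop := fun t s' =>
    (∀ i ≠ 4, i ≠ 5 → s'.nat i = s.nat i) ∧ s'.nat 5 = s.nat 5 + t ∧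
      (s'.real 2 = ε ∧ s'.real 5 = M g) ∧ (∀ j : Fin n, s'.arr 0 j = g j) ∧
      (∀ l < s.nat 5, s'.arr 1 l = s.arr 1 l) ∧
      (∀ j : Fin n, j.1 < t → s'.arr 1 (s.nat 5 + j) = finiteDiff M ε g j) ∧
      s'.drawn = s.drawn ∧ s'.queries = Q t ∧ s'.steps = s.steps + 2 + n + t * (n + 10)
  have hP : P n (exec M ω computeGradient s) := by
    rw [computeGradient, exec]
    refine exec_loop_induction (by simpa [exec, State.tick, State.setReal] using h) P ?_ ?_
    · simp [P, Q, exec, State.tick, State.setReal, hε, hg]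
      ring
    · rintro t ht u ⟨h1, h2, ⟨h3, h3'⟩, h4, h5, h6, h7, h8, h9⟩
      have hut : u.arr 0 t = g ⟨t, ht⟩ := h4 ⟨t, ht⟩
      have hpt : (fun j : Fin n => Function.update (u.arr 0) t (g ⟨t, ht⟩ + ε) j) =
          Function.update g ⟨t, ht⟩ (g ⟨t, ht⟩ + ε) := by
        ext j
        by_cases hj : j = ⟨t, ht⟩
        · subst hj; simp
        · rw [Function.update_of_ne hj, Function.update_of_ne (fun h => hj (Fin.ext h)), h4]
      refine ⟨fun i hi hi' => ?_, ?_, ⟨?_, ?_⟩, fun j => ?_, fun l hl => ?_, fun j hj => ?_,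
        ?_, ?_, ?_⟩
      · simp [exec, State.tick, State.setNat, State.setReal, State.setArr, hi, hi', h1]
      · simp [exec, State.tick, State.setNat, State.setReal, State.setArr, h2, add_assoc]
      · simp [exec, State.tick, State.setNat, State.setReal, State.setArr, h3]
      · simp [exec, State.tick, State.setNat, State.setReal, State.setArr, h3']
      · by_cases hj : j = ⟨t, ht⟩
        · subst hj
          simp [exec, State.tick, State.setNat, State.setReal, State.setArr, hut]
        · simp [exec, State.tick, State.setNat, State.setReal, State.setArr, h4]
      · have : l ≠ s.nat 5 + t := by omega
        simp [exec, State.tick, State.setNat, State.setReal, State.setArr, h2, this, h5 l hl]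
      · rcases Nat.lt_succ_iff_lt_or_eq.1 hj with hj' | hj'
        · simp [exec, State.tick, State.setNat, State.setReal, State.setArr, h2, hj'.ne, h6 j hj']
        · obtain rfl : j = ⟨t, ht⟩ := Fin.ext hj'
          simp [exec, State.tick, State.setNat, State.setReal, State.setArr, ArithOp.eval, h2,
            h3, h3', hut, hpt, finiteDiff]
      · simp [exec, State.tick, State.setNat, State.setReal, State.setArr, h7]
      · have hQ : Q (t + 1) = Function.update g ⟨t, ht⟩ (g ⟨t, ht⟩ + ε) :: Q t := by
          simp [Q, List.take_add_one, ht]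
        simp [exec, State.tick, State.setNat, State.setReal, State.setArr, ArithOp.eval,
          h3, hut, hpt, h8, hQ]
      · simp [exec, State.tick, State.setNat, State.setReal, State.setArr, h9]
        ring
  obtain ⟨h1, h2, ⟨h3, -⟩, -, h5, h6, h7, h8, h9⟩ := hP
  refine ⟨h1, h2, h3, h5, fun j => h6 j j.2, h7, ?_, ?_⟩
  · rw [h8]
    simp [Q, gradientQueries]
  · rw [h9]
    ring

/-- The final configuration of the algorithm, for every oracle and every random tape. -/
lemma run_afterRounds {n : ℕ} (M : (Fin n → ℝ) → ℝ) (ω : ℕ → ℝ) (C k : ℕ) (γ δ ε : ℝ) :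
    let r := ⌈C * (k * Real.log (k / δ)) / γ⌉₊
    (run C k γ δ ε M ω).AfterRounds M ω ε r (9 + r) r := by
  intro r
  rw [run, spanRecovery, exec]
  have h0 := exec_setRounds M ω C k γ δ ε
  change State.AfterRounds M ω ε r (8 + r) 0 _ at h0
  generalize exec M ω (setRounds C) (input n k γ δ ε) = s₀ at h0 ⊢
  refine exec_loop_induction h0.rounds (State.AfterRounds M ω ε r (9 + r)) ?_ ?_
  · exact ⟨h0.dim, h0.rounds, h0.step, h0.free, h0.drawn, h0.queries,
      by simp only [State.tick, h0.steps]; ring, fun i hi => absurd hi (Nat.not_lt_zero i)⟩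
  · intro t _ s hs
    rw [exec]
    have hn₁ : ∀ i ≠ 3, ((s.setNat 3 t).tick 1).nat i = s.nat i := fun i hi => by
      simp [State.tick, State.setNat, hi]
    have hreal : ((s.setNat 3 t).tick 1).real = s.real := rfl
    have harr : ((s.setNat 3 t).tick 1).arr = s.arr := rfl
    have hq : ((s.setNat 3 t).tick 1).queries = s.queries := rfl
    have hsteps : ((s.setNat 3 t).tick 1).steps = s.steps + 1 := rfl
    have hd : ((s.setNat 3 t).tick 1).drawn = t * n := hs.drawn
    generalize (s.setNat 3 t).tick 1 = s₁ at hn₁ hreal harr hq hsteps hd ⊢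
    obtain ⟨a1, a2, a3, a4, a5, a6, a7⟩ := exec_drawPoint M ω s₁ ((hn₁ 0 (by decide)).trans hs.dim)
    generalize exec M ω drawPoint s₁ = s₂ at a1 a2 a3 a4 a5 a6 a7 ⊢
    obtain ⟨b1, b2, b3, b4, b5, b6, b7, b8⟩ := exec_computeGradient M ω s₂
      (by rw [a1 0 (by decide), hn₁ 0 (by decide), hs.dim])
      (by rw [a2 2 (by decide), hreal, hs.step]) (tapeBlocks n ω t)
      (fun j => by rw [a4, hd, tapeBlocks])
    generalize exec M ω computeGradient s₂ = s₃ at b1 b2 b3 b4 b5 b6 b7 b8 ⊢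
    have h5 : s₂.nat 5 = t * n := by rw [a1 5 (by decide), hn₁ 5 (by decide), hs.free]
    refine ⟨?_, ?_, b3, ?_, ?_, ?_, ?_, fun i hi j => ?_⟩
    · rw [b1 0 (by decide) (by decide), a1 0 (by decide), hn₁ 0 (by decide), hs.dim]
    · rw [b1 2 (by decide) (by decide), a1 2 (by decide), hn₁ 2 (by decide), hs.rounds]
    · rw [b2, h5]; ring
    · rw [b6, a5, hd]; ring
    · rw [b7, a6, hq, hs.queries, roundQueries]
    · rw [b8, a7, hsteps, hs.steps]; ring
    · rcases Nat.lt_succ_iff_lt_or_eq.1 hi with hi | rfl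
      · have hlt : i * n + j < t * n := calc
          i * n + j < (i + 1) * n := by rw [add_mul, one_mul]; exact Nat.add_lt_add_left j.2 _
          _ ≤ t * n := Nat.mul_le_mul_right n hi
        rw [b4 _ (by rw [h5]; exact hlt), a3, harr]
        exact hs.gradients i hi j
      · rw [← h5, b5]

lemma run_output {n : ℕ} (M : (Fin n → ℝ) → ℝ) (ω : ℕ → ℝ) (C k : ℕ) (γ δ ε : ℝ) :
    (run C k γ δ ε M ω).output = Submodule.span ℝ (Set.range
      fun i : Fin ⌈C * (k * Real.log (k / δ)) / γ⌉₊ => finiteDiff M ε (tapeBlocks n ω i)) := by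
  have h := run_afterRounds M ω C k γ δ ε
  rw [State.output, h.rounds]
  congr 1
  ext z
  constructor
  · rintro ⟨i, hi, rfl⟩
    exact ⟨⟨i, hi⟩, funext fun j => (h.gradients i hi j).symm⟩
  · rintro ⟨i, rfl⟩
    exact ⟨i, i.2, funext fun j => (h.gradients i i.2 j).symm⟩

/-! ### The failure probability -/

lemma span_range_vecMul {n k : ℕ} {A : Matrix (Fin k) (Fin n) ℝ} (hA : A.rank = k)
    {r : ℕ} {z : Fin r → Fin n → ℝ} {v : Fin r → Fin k → ℝ} (hz : ∀ i, z i = v i ᵥ* A) :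
    Submodule.span ℝ (Set.range z) ≤ Submodule.span ℝ (Set.range A.row) ∧
      Module.finrank ℝ (Submodule.span ℝ (Set.range z)) =
        Module.finrank ℝ (Submodule.span ℝ (Set.range v)) := by
  have hinj : Function.Injective A.vecMulLinear := by
    have : LinearIndependent ℝ A.row := by
      rw [linearIndependent_iff_card_eq_finrank_span, Set.finrank, ← A.rank_eq_finrank_span_row,
        hA, Fintype.card_fin]
    exact Matrix.vecMul_injective_iff.2 this
  have hmap : Submodule.span ℝ (Set.range z) =
      (Submodule.span ℝ (Set.range v)).map A.vecMulLinear := by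
    rw [Submodule.map_span, ← Set.range_comp]
    congr 2
    exact funext hz
  refine ⟨?_, ?_⟩
  · rw [hmap, ← range_vecMulLinear]
    exact LinearMap.map_le_range
  · rw [hmap]
    exact LinearEquiv.finrank_eq (Submodule.equivMapOfInjective _ hinj _).symm

/-- There are two ways to fail: some finite difference is not the true gradient, which is rare by a
union bound over the rounds, or the true gradients span too little, which the growth estimate makes
rare. -/
lemma tapeMeasure_failure_le {n k a : ℕ} {w : Fin a → ℝ} {L : Layers k a}
    {A : Matrix (Fin k) (Fin n) ℝ} {γ ε : ℝ} (hγ : 0 < γ) (hA : OrthantAssumption A γ)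
    (hM : NondegeneracyAssumption w L A γ) (hε : 0 < ε) (r : ℕ) :
    tapeMeasure ({ω | ∃ i : Fin r, finiteDiff (network w L A) ε (tapeBlocks n ω i) ≠
        gradCoeff w L A (tapeBlocks n ω i) ᵥ* A} ∪
      {ω | 2 * Module.finrank ℝ (Submodule.span ℝ (Set.range
        fun i : Fin r => gradCoeff w L A (tapeBlocks n ω i))) < k}) ≤
      ENNReal.ofReal (r * (4 ^ (k + L.neurons) * (2 * ε)) +
        2 ^ k * (1 - 3 * γ / 16) ^ r) := by
  have hγ1 := hA.le_one
  have hmeas : Measurable fun ω (i : Fin r) => tapeBlocks n ω i := by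
    unfold tapeBlocks; fun_prop
  have hmap := tapeMeasure_map_blocks n r
  have hpos : 0 ≤ 1 - 3 * γ / 16 := by linarith
  rw [ENNReal.ofReal_add (by positivity) (by positivity)]
  refine (measure_union_le _ _).trans (add_le_add ?_ ?_)
  · have hU : {ω | ∃ i : Fin r, finiteDiff (network w L A) ε (tapeBlocks n ω i) ≠
        gradCoeff w L A (tapeBlocks n ω i) ᵥ* A} = ⋃ i : Fin r, (fun ω => tapeBlocks n ω i) ⁻¹'
          {g | finiteDiff (network w L A) ε g ≠ gradCoeff w L A g ᵥ* A} := by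
      ext ω; simp
    rw [hU]
    refine (measure_iUnion_fintype_le _ _).trans ?_
    calc _ ≤ ∑ _i : Fin r, ENNReal.ofReal (4 ^ (k + L.neurons) * (2 * ε)) := by
          refine Finset.sum_le_sum fun i _ => le_trans ?_ (gaussianVector_finiteDiff_ne_le w L A hε)
          have hi : tapeMeasure.map (fun ω => tapeBlocks n ω i) = gaussianVector n := by
            rw [← (measurePreserving_eval (fun _ : Fin r => gaussianVector n) i).map_eq, ← hmap,
              Measure.map_map (measurable_pi_apply i) hmeas]
            rfl
          rw [← hi]
          exact Measure.le_map_apply ((measurable_pi_apply i).comp hmeas).aemeasurable _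
      _ = _ := by
          rw [Finset.sum_const, nsmul_eq_mul, Finset.card_univ, Fintype.card_fin,
            ENNReal.ofReal_mul (Nat.cast_nonneg r), ENNReal.ofReal_natCast]
  · have hK : ∀ m : ℕ, m < (k + 1) / 2 ↔ 2 * m < k := fun m => by omega
    have h := pi_finrank_lt_le (gaussianVector n) (measurable_gradCoeff w L A)
      (finite_range_gradCoeff w L A) ((k + 1) / 2) (p := 3 * γ / 8) (by linarith)
      (fun U hU => le_measureReal_gradCoeff_notMem hγ hA hM U ((hK _).1 hU)) r
    rw [← hmap] at h
    simp only [hK] at h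
    refine (Measure.le_map_apply hmeas.aemeasurable _).trans
      (h.trans (ENNReal.ofReal_le_ofReal ?_))
    rw [div_div, show (8 : ℝ) * 2 = 16 by norm_num]
    gcongr
    · exact one_le_two
    · omega

/-! ### Choice of the constants -/

/-- The rounding is absorbed into the constant since `k ≥ 3` and `γ ≤ 1` make the number before
rounding at least `1`, uniformly in `δ < 1`. -/
lemma rounds_le {k : ℕ} {γ δ : ℝ} (hk : 3 ≤ k) (hγ : 0 < γ) (hγ1 : γ ≤ 1) (hδ : 0 < δ)
    (hδ1 : δ < 1) : (⌈(16 : ℕ) * (k * Real.log (k / δ)) / γ⌉₊ : ℝ) ≤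
      17 * (k * Real.log (k / δ) / γ) := by
  have hk' : (3 : ℝ) ≤ k := by exact_mod_cast hk
  have hlog : 1 ≤ Real.log (k / δ) := by
    rw [Real.le_log_iff_exp_le (by positivity), le_div_iff₀ hδ]
    nlinarith [Real.exp_one_lt_d9, Real.exp_pos 1]
  have h1 : 1 ≤ k * Real.log (k / δ) / γ := by
    rw [le_div_iff₀ hγ]
    nlinarith
  have h2 := (Nat.ceil_lt_add_one (a := (16 : ℕ) * (k * Real.log (k / δ)) / γ)
    (by positivity)).le
  rw [mul_div_assoc] at h2 ⊢
  push_cast at h2 ⊢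
  linarith

lemma pow_rounds_le {k : ℕ} {γ δ : ℝ} (hk : 3 ≤ k) (hγ : 0 < γ) (hγ1 : γ ≤ 1) (hδ : 0 < δ)
    (hδ1 : δ < 1) :
    2 ^ k * (1 - 3 * γ / 16) ^ ⌈(16 : ℕ) * (k * Real.log (k / δ)) / γ⌉₊ ≤ δ / 2 := by
  have hk' : (3 : ℝ) ≤ k := by exact_mod_cast hk
  set r := ⌈(16 : ℕ) * (k * Real.log (k / δ)) / γ⌉₊
  -- With the factor `16`, the exponent `3γr/16` is at least `3k log(k/δ)`.
  have hr : 16 * (k * Real.log (k / δ)) ≤ r * γ := by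
    rw [← div_le_iff₀ hγ]
    exact_mod_cast Nat.le_ceil _
  have hx : δ / k ≤ 1 / 3 := by
    rw [div_le_div_iff₀ (by positivity) (by norm_num)]
    linarith
  have hxδ : δ / k ≤ δ / 3 := by gcongr
  have hx0 : 0 < δ / k := by positivity
  have h1 : (1 - 3 * γ / 16) ^ r ≤ ((δ / k) ^ 3) ^ k := by
    calc (1 - 3 * γ / 16) ^ r ≤ Real.exp (-(3 * γ / 16)) ^ r :=
          pow_le_pow_left₀ (by linarith) (Real.one_sub_le_exp_neg _) _
      _ = Real.exp (-(3 / 16 * (r * γ))) := by rw [← Real.exp_nat_mul]; congr 1; ring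
      _ ≤ Real.exp ((3 * k : ℕ) * Real.log (δ / k)) := by
          rw [← inv_div (k : ℝ) δ, Real.log_inv]
          push_cast
          exact Real.exp_le_exp.2 (by linarith)
      _ = _ := by rw [Real.exp_nat_mul, Real.exp_log hx0, pow_mul]
  have hy : 2 * (δ / k) ^ 3 ≤ δ / 2 := by
    have : (δ / k) ^ 2 ≤ 1 := pow_le_one₀ hx0.le (by linarith)
    have h2 : (δ / k) ^ 2 ≤ (1 / 3) ^ 2 := pow_le_pow_left₀ hx0.le hx 2
    nlinarith
  calc _ ≤ 2 ^ k * ((δ / k) ^ 3) ^ k := by gcongr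
    _ = (2 * (δ / k) ^ 3) ^ k := (mul_pow _ _ _).symm
    _ ≤ 2 * (δ / k) ^ 3 := pow_le_of_le_one (by positivity) (by linarith) (by omega)
    _ ≤ δ / 2 := hy

lemma rounds_mul_le {k N : ℕ} {γ δ ε : ℝ} (hk : 3 ≤ k) (hkN : k ≤ N) (hγ : 0 < γ) (hγ1 : γ ≤ 1)
    (hδ : 0 < δ) (hδ1 : δ < 1) (hε0 : 0 < ε) (hε : ε ≤ γ * δ ^ 2 / 2 ^ (11 * N)) :
    ⌈(16 : ℕ) * (k * Real.log (k / δ)) / γ⌉₊ * (4 ^ N * (2 * ε)) ≤ δ / 2 := by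
  have hlog : Real.log (k / δ) ≤ k / δ := Real.log_le_self (by positivity)
  have hk2 : (k : ℝ) ≤ 2 ^ N := by exact_mod_cast hkN.trans (Nat.lt_two_pow_self).le
  -- The exponent `11` is spent as `7` for the constant `2 * 17 * 2 = 68`, `2` for `k ^ 2` and `2`
  -- for the number `4 ^ N` of hyperplanes.
  have h68 : (68 : ℝ) ≤ (2 ^ N) ^ 7 := by
    have : (2 : ℝ) ≤ 2 ^ N := le_self_pow₀ one_le_two (by omega)
    calc (68 : ℝ) ≤ 2 ^ 7 := by norm_num
      _ ≤ _ := by gcongr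
  calc _ ≤ 17 * (k * (k / δ) / γ) * (4 ^ N * (2 * (γ * δ ^ 2 / 2 ^ (11 * N)))) := by
        refine mul_le_mul ((rounds_le hk hγ hγ1 hδ hδ1).trans ?_) ?_ (by positivity)
          (by positivity)
        all_goals gcongr
    _ = δ / 2 * (68 * (k ^ 2 * (2 ^ N) ^ 2) / (2 ^ N) ^ 11) := by
        rw [show (4 : ℝ) = 2 ^ 2 by norm_num, ← pow_mul, ← pow_mul, ← pow_mul, mul_comm N 11,
          mul_comm N 2]
        field_simp
        ring
    _ ≤ δ / 2 * 1 := by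
        refine mul_le_mul_of_nonneg_left ?_ (by positivity)
        rw [div_le_one (by positivity)]
        calc _ ≤ (2 ^ N) ^ 7 * ((2 ^ N) ^ 2 * (2 ^ N) ^ 2) := by gcongr
          _ = (2 ^ N : ℝ) ^ 11 := by ring
    _ = δ / 2 := mul_one _

end SpanRecovery

end

theorem theorem3p4 :
    ∃ (C c : ℕ) (K : ℝ) (T : MvPolynomial (Fin 4) ℝ),
      ∀ (n k a : ℕ) (w : Fin a → ℝ) (L : SpanRecovery.Layers k a)
        (A : Matrix (Fin k) (Fin n) ℝ) (γ δ ε : ℝ),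
        A.rank = k → 0 < γ → 0 < δ → δ < 1 →
        SpanRecovery.OrthantAssumption A γ →
        SpanRecovery.NondegeneracyAssumption w L A γ →
        0 < ε → ε ≤ γ * δ ^ 2 / 2 ^ (c * (k + L.neurons)) →
        -- the query points are chosen non-adaptively
        (∀ (M' : (Fin n → ℝ) → ℝ) (ω : ℕ → ℝ),
          (SpanRecovery.run C k γ δ ε (SpanRecovery.network w L A) ω).queries =
            (SpanRecovery.run C k γ δ ε M' ω).queries) ∧
        -- number of queries
        (∀ ω : ℕ → ℝ,
          ((SpanRecovery.run C k γ δ ε (SpanRecovery.network w L A) ω).queries.length : ℝ) ≤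
            K * (k * n * Real.log (k / δ) / γ)) ∧
        -- running time
        (∀ ω : ℕ → ℝ,
          ((SpanRecovery.run C k γ δ ε (SpanRecovery.network w L A) ω).steps : ℝ) ≤
            MvPolynomial.eval ![(n : ℝ), (k : ℝ), 1 / γ, Real.log (1 / δ)] T) ∧
        -- correctness
        ENNReal.ofReal (1 - δ) ≤ SpanRecovery.tapeMeasure
          {ω | (SpanRecovery.run C k γ δ ε (SpanRecovery.network w L A) ω).output ≤
                Submodule.span ℝ (Set.range A.row) ∧
              (k : ℝ) / 2 ≤ Module.finrank ℝ
                (SpanRecovery.run C k γ δ ε (SpanRecovery.network w L A) ω).output} := by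
  open MvPolynomial in
  refine ⟨16, 11, 34, 9 + 17 * (X 1 * (X 1 + X 3) * X 2) * (X 0 ^ 2 + 14 * X 0 + 5), ?_⟩
  intro n k a w L A γ δ ε hrank hγ hδ hδ1 hA hM hε0 hε
  have hk : 3 ≤ k := SpanRecovery.three_le_width hγ hA hM
  have hγ1 : γ ≤ 1 := hA.le_one
  have hkn : k ≤ n := hrank ▸ A.rank_le_width
  have hr := SpanRecovery.rounds_le hk hγ hγ1 hδ hδ1
  have hrun := fun M ω => SpanRecovery.run_afterRounds (n := n) M ω 16 k γ δ ε
  have hout := fun M ω => SpanRecovery.run_output (n := n) M ω 16 k γ δ ε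
  have hpow := SpanRecovery.pow_rounds_le hk hγ hγ1 hδ hδ1
  have hmul := SpanRecovery.rounds_mul_le hk (Nat.le_add_right k L.neurons) hγ hγ1 hδ hδ1 hε0 hε
  dsimp only at hrun
  generalize ⌈(16 : ℕ) * (k * Real.log (k / δ)) / γ⌉₊ = r at hr hrun hout hpow hmul
  have hkR : (3 : ℝ) ≤ k := by exact_mod_cast hk
  have hnR : (3 : ℝ) ≤ n := by exact_mod_cast hk.trans hkn
  have hlog : 0 ≤ Real.log (k / δ) :=
    Real.log_nonneg (by rw [one_le_div hδ]; linarith)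
  refine ⟨fun M' ω => by rw [(hrun _ ω).queries, (hrun M' ω).queries], fun ω => ?_, fun ω => ?_, ?_⟩
  · rw [(hrun _ ω).queries, SpanRecovery.length_roundQueries]
    push_cast
    calc (r : ℝ) * (n + 1) ≤ 17 * (k * Real.log (k / δ) / γ) * (2 * n) := by
          gcongr
          linarith
      _ = _ := by ring
  · rw [(hrun _ ω).steps]
    have hr' : (r : ℝ) ≤ 17 * (k * (k + Real.log (1 / δ)) * (1 / γ)) := by
      refine hr.trans ?_
      rw [mul_one_div]
      gcongr
      rw [div_eq_mul_one_div, Real.log_mul (by positivity) (by positivity)]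
      gcongr
      exact Real.log_le_self (by positivity)
    have heval : MvPolynomial.eval ![(n : ℝ), (k : ℝ), 1 / γ, Real.log (1 / δ)]
        (9 + 17 * (.X 1 * (.X 1 + .X 3) * .X 2) * (.X 0 ^ 2 + 14 * .X 0 + 5)) =
        9 + 17 * (k * (k + Real.log (1 / δ)) * (1 / γ)) * (n ^ 2 + 14 * n + 5) := by
      simp
    rw [heval]
    push_cast
    calc (9 + r + r * (n ^ 2 + 14 * n + 4) : ℝ) = 9 + r * (n ^ 2 + 14 * n + 5) := by ring
      _ ≤ _ := by gcongr
  · have hfail := SpanRecovery.tapeMeasure_failure_le hγ hA hM hε0 r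
    -- Subadditivity bounds the success event from below without measurability of either event.
    rw [ENNReal.ofReal_sub _ hδ.le, ENNReal.ofReal_one, tsub_le_iff_right,
      ← measure_univ (μ := SpanRecovery.tapeMeasure)]
    refine (measure_mono ?_).trans ((measure_union_le _ _).trans (add_le_add_right
      (hfail.trans (ENNReal.ofReal_le_ofReal (by linarith))) _))
    rw [← Set.compl_subset_iff_union.trans Set.univ_subset_iff.symm, Set.compl_subset_comm]
    intro ω hω
    rw [Set.mem_compl_iff, Set.mem_union, not_or] at hω
    obtain ⟨h1, h2⟩ := hω
    simp only [Set.mem_ofPred_eq, not_exists, not_not, not_lt] at h1 h2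
    obtain ⟨h3, h4⟩ := SpanRecovery.span_range_vecMul hrank h1
    rw [Set.mem_ofPred_eq, hout, h4]
    refine ⟨h3, ?_⟩
    rw [div_le_iff₀ two_pos]
    exact_mod_cast (mul_comm 2 _) ▸ h2
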